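/- **Finite dimension.** Let $N\ge 1$ and let $\sigma\in\mathbb R^{N\times N}$ have nonnegative off-diagonal entries. Put $X=\mathbb R^N$ with the Euclidean scalar product, $e=(1,\dots,1)^\intercal$ and $A=\sigma-\operatorname{diag}(\sigma e)$. Let $G$ be the directed graph with vertices $1,\dots,N$ and an edge from $i$ to $j$ when $\sigma_{ij}>0$. It is called strongly connected if for all $i\ne j$ there are $r\ge1$ and pairwise distinct indices $i_0=i,i_1,\dots,i_r=j$ with $\sigma_{i_ki_{k+1}}>0$ for $0\le k<r$. **Infinite dimension.** Let $d\ge1$, let $\Omega\subset\mathbb R^d$ be a nonempty bounded open set with Lebesgue measure, and let $\sigma\in L^\infty(\Omega^2)$ with $\sigma\ge 0$ a.e. Put $X=L^2(\Omega)$ (real-valued), $e=1$, and $$(Az)(x)=\int_\Omega\sigma(x,x_*)\,(z(x_*)-z(x))\,\mathrm dx_*\quad\text{for a.e. }x\in\Omega,\qquad S(x)=\int_\Omega\sigma(x,x_*)\,\mathrm dx_* .$$ A Lebesgue point of $\sigma$ is a point $x\in\Omega$ for which there is $\sigma(x,\cdot)\in L^1(\Omega)$ (then unique) such that the mean of $\|\sigma(x',\cdot)-\sigma(x,\cdot)\|_{L^1(\Omega)}$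 over $x'\in B(x,r)$ tends to $0$ as $r\to0$. For $g\in L^1(\Omega)$, $\operatorname{ess\,supp} g$ denotes the measure-theoretic support of $g$, i.e. the set of points $y\in\Omega$ at which $\{g\neq0\}$ does not have density $0$. Let $G$ be the directed graph whose vertices are the Lebesgue points of $\sigma$, with an arc from $x_1$ to $x_2\neq x_1$ when $x_2\in\operatorname{ess\,supp}\sigma(x_1,\cdot)$. It is called strongly connected if any two distinct vertices $x,x_*$ are joined by a path $x_0=x,x_1,\dots,x_r=x_*$ ($r\ge1$) of pairwise distinct vertices with an arc from $x_k$ to $x_{k+1}$ for $0\le k<r$, and if moreover $\operatorname{ess\,inf}S>0$. **Theorem.** In either case assume that $G$ is strongly connected. Then there exists a unique $v\in\ker A^*$ such that $v>0$ (all coordinates positive if $X=\mathbb R^N$; positive almost everywhere if $X=L^2(\Omega)$) and $\langle v,e\rangle=1$. Moreover, for every solution $y:[0,\infty)\to X$ of $\dot y(t)=Ay(t)$, the weighted mean $\bar y^v=\langle y(t),v\rangle\,e$ does not depend on $t\ge0$. -/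

import Mathlib

open MeasureTheory Filter Set Topology
open scoped ENNReal

noncomputable section

namespace Consensus

/-! ### Directed graphs -/

/-- There is a path `p 0, …, p r`, `r ≥ 1`, of pairwise distinct vertices joining `a` to `b`. -/
def HasPath {V : Type*} (G : Digraph V) (a b : V) : Prop :=
  ∃ r : ℕ, 1 ≤ r ∧ ∃ p : Fin (r + 1) → V, Function.Injective p ∧
    p 0 = a ∧ p (Fin.last r) = b ∧ ∀ k : Fin r, G.Adj (p k.castSucc) (p k.succ)

/-- Any two distinct vertices are joined by a path. -/
def IsConnectedByPaths {V : Type*} (G : Digraph V) : Prop :=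
  ∀ a b : V, a ≠ b → HasPath G a b

/-! ### Solutions and weighted means in a Hilbert space -/

section Hilbert

variable {X : Type*} [NormedAddCommGroup X] [InnerProductSpace ℝ X]

/-- `y` solves `y' = A y` on `[0, ∞)` (one-sided derivative at `0`); only the values of `y` on
`[0, ∞)` matter. Since `A` is bounded, such a `y` is automatically `C¹` on `[0, ∞)`. -/
def IsSolution (A : X →L[ℝ] X) (y : ℝ → X) : Prop :=
  ∀ t : ℝ, 0 ≤ t → HasDerivWithinAt y (A (y t)) (Ici 0) t

/-- The `v`-weighted mean `⟨z, v⟩ e`. -/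
def weightedMean (e v z : X) : X := (inner ℝ z v) • e

end Hilbert

/-! ### Finite dimension -/

section Finite

variable {N : ℕ}

/-- The directed graph of `σ`: an edge from `i` to `j` when `σ i j > 0`. -/
def matrixGraph (σ : Matrix (Fin N) (Fin N) ℝ) : Digraph (Fin N) where
  Adj i j := 0 < σ i j

/-- The matrix `A = σ - diag (σ e)`. -/
def consensusMatrix (σ : Matrix (Fin N) (Fin N) ℝ) : Matrix (Fin N) (Fin N) ℝ :=
  σ - Matrix.diagonal (fun i => ∑ j, σ i j)

/-- `A` as an operator on Euclidean space. -/
def consensusMatrixOp (σ : Matrix (Fin N) (Fin N) ℝ) :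
    EuclideanSpace ℝ (Fin N) →L[ℝ] EuclideanSpace ℝ (Fin N) :=
  Matrix.toEuclideanCLM (𝕜 := ℝ) (consensusMatrix σ)

/-- The vector `e = (1, …, 1)`. -/
def onesVec (N : ℕ) : EuclideanSpace ℝ (Fin N) := WithLp.toLp 2 (fun _ => 1)

end Finite

/-! ### Integral operators on a finite measure space -/

section Kernel

variable {α : Type*} [MeasurableSpace α] (μ : Measure α) [IsFiniteMeasure μ]

/-- The constant function `e = 1` of `L²`. -/
def onesFun : Lp ℝ 2 μ := Lp.const 2 μ (1 : ℝ)

variable {μ}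

/-- The function `S(x) = ∫ σ(x, x') dx'`. -/
def totalInfluence (σ : Lp ℝ ∞ (μ.prod μ)) (x : α) : ℝ := ∫ x', σ (x, x') ∂μ

/-- The function `x ↦ ∫ σ(x, x') (z(x') - z(x)) dx'`. -/
def consensusFun (σ : Lp ℝ ∞ (μ.prod μ)) (z : α → ℝ) (x : α) : ℝ :=
  ∫ x', σ (x, x') * (z x' - z x) ∂μ

lemma kernel_ae_bound (σ : Lp ℝ ∞ (μ.prod μ)) :
    ∀ᵐ x ∂μ, ∀ᵐ x' ∂μ, ‖σ (x, x')‖ ≤ ‖σ‖ := by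
  have h : ∀ᵐ p ∂(μ.prod μ), ‖σ p‖ ≤ ‖σ‖ := by
    filter_upwards [enorm_ae_le_eLpNormEssSup (σ : α × α → ℝ) (μ.prod μ)] with p hp
    rw [Lp.norm_def, eLpNorm_exponent_top]
    have hfin : eLpNormEssSup (σ : α × α → ℝ) (μ.prod μ) ≠ ∞ := by
      rw [← eLpNorm_exponent_top]; exact Lp.eLpNorm_ne_top σ
    have := ENNReal.toReal_mono hfin hp
    simpa using this
  exact Measure.ae_ae_of_ae_prod h

lemma integrable_coe (z : Lp ℝ 2 μ) : Integrable (z : α → ℝ) μ :=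
  (Lp.memLp z).integrable (by norm_num)

lemma consensusFun_stronglyMeasurable (σ : Lp ℝ ∞ (μ.prod μ)) (z : Lp ℝ 2 μ) :
    StronglyMeasurable (consensusFun σ z) := by
  have hz := Lp.stronglyMeasurable z
  refine StronglyMeasurable.integral_prod_right' (f := fun p : α × α =>
    σ p * (z p.2 - z p.1)) ?_
  exact (Lp.stronglyMeasurable σ).mul
    ((hz.comp_measurable measurable_snd).sub (hz.comp_measurable measurable_fst))

lemma consensus_integrable (σ : Lp ℝ ∞ (μ.prod μ)) (z : Lp ℝ 2 μ) :
    ∀ᵐ x ∂μ, Integrable (fun x' => σ (x, x') * (z x' - z x)) μ := by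
  filter_upwards [kernel_ae_bound σ] with x hx
  exact ((integrable_coe z).sub (integrable_const (z x))).bdd_mul
    ((Lp.stronglyMeasurable σ).comp_measurable measurable_prodMk_left).aestronglyMeasurable hx

/-- An `L²` majorant of `consensusFun σ z`. -/
def consensusMajorant (σ : Lp ℝ ∞ (μ.prod μ)) (z : Lp ℝ 2 μ) : Lp ℝ 2 μ :=
  (‖σ‖ * ∫ x', |z x'| ∂μ) • onesFun μ + (‖σ‖ * μ.real univ) • |z|

lemma consensusFun_le (σ : Lp ℝ ∞ (μ.prod μ)) (z : Lp ℝ 2 μ) :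
    ∀ᵐ x ∂μ, ‖consensusFun σ z x‖ ≤ ‖consensusMajorant σ z x‖ := by
  filter_upwards [kernel_ae_bound σ, Lp.coeFn_abs z,
    Lp.coeFn_add ((‖σ‖ * ∫ x', |z x'| ∂μ) • onesFun μ) ((‖σ‖ * μ.real univ) • |z|),
    Lp.coeFn_smul (‖σ‖ * ∫ x', |z x'| ∂μ) (onesFun μ),
    Lp.coeFn_smul (‖σ‖ * μ.real univ) |z|,
    Lp.coeFn_const (p := 2) (μ := μ) (c := (1 : ℝ))] with x hx habs hadd hs1 hs2 hone
  have hval : consensusMajorant σ z x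
      = ‖σ‖ * ((∫ x', |z x'| ∂μ) + μ.real univ * |z x|) := by
    unfold consensusMajorant
    rw [hadd, Pi.add_apply, hs1, hs2, Pi.smul_apply, Pi.smul_apply, habs]
    unfold onesFun
    rw [hone]
    simp only [Function.const_apply, smul_eq_mul]
    ring
  have hzi : Integrable (fun x' => |z x'|) μ := (integrable_coe z).abs
  rw [hval]
  refine le_trans ?_ (le_abs_self _)
  calc ‖consensusFun σ z x‖
      ≤ ∫ x', ‖σ‖ * (|z x'| + |z x|) ∂μ := by
        refine norm_integral_le_of_norm_le ((hzi.add (integrable_const _)).const_mul _) ?_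
        filter_upwards [hx] with x' hx'
        rw [norm_mul]
        exact mul_le_mul hx' (abs_sub _ _) (norm_nonneg _) (norm_nonneg _)
    _ = ‖σ‖ * ((∫ x', |z x'| ∂μ) + μ.real univ * |z x|) := by
        rw [integral_const_mul, integral_add hzi (integrable_const _), integral_const,
          smul_eq_mul]

lemma consensusFun_memLp (σ : Lp ℝ ∞ (μ.prod μ)) (z : Lp ℝ 2 μ) :
    MemLp (consensusFun σ z) 2 μ :=
  (Lp.memLp (consensusMajorant σ z)).of_le
    (consensusFun_stronglyMeasurable σ z).aestronglyMeasurable (consensusFun_le σ z)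

lemma consensusFun_add (σ : Lp ℝ ∞ (μ.prod μ)) (z w : Lp ℝ 2 μ) :
    consensusFun σ (z + w : Lp ℝ 2 μ) =ᵐ[μ] consensusFun σ z + consensusFun σ w := by
  have h := Lp.coeFn_add z w
  filter_upwards [h, consensus_integrable σ z, consensus_integrable σ w] with x hx hz hw
  simp only [consensusFun, Pi.add_apply]
  rw [← integral_add hz hw]
  refine integral_congr_ae ?_
  filter_upwards [h] with x' hx'
  rw [hx, hx', Pi.add_apply, Pi.add_apply]
  ring

set_option linter.unusedSectionVars false in
lemma consensusFun_smul (σ : Lp ℝ ∞ (μ.prod μ)) (c : ℝ) (z : Lp ℝ 2 μ) :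
    consensusFun σ (c • z : Lp ℝ 2 μ) =ᵐ[μ] c • consensusFun σ z := by
  have h := Lp.coeFn_smul c z
  filter_upwards [h] with x hx
  simp only [consensusFun, Pi.smul_apply, smul_eq_mul]
  rw [← integral_const_mul]
  refine integral_congr_ae ?_
  filter_upwards [h] with x' hx'
  rw [hx, hx', Pi.smul_apply, Pi.smul_apply, smul_eq_mul, smul_eq_mul]
  ring

lemma norm_consensusMajorant_le (σ : Lp ℝ ∞ (μ.prod μ)) (z : Lp ℝ 2 μ) :
    ‖consensusMajorant σ z‖ ≤ (‖σ‖ * ‖onesFun μ‖ ^ 2 + ‖σ‖ * μ.real univ) * ‖z‖ := by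
  have hint : ∫ x', |z x'| ∂μ = inner ℝ (onesFun μ) |z| := by
    rw [L2.inner_def]
    refine integral_congr_ae ?_
    filter_upwards [Lp.coeFn_abs z,
      Lp.coeFn_const (p := 2) (μ := μ) (c := (1 : ℝ))] with x h1 h2
    unfold onesFun
    rw [h1, h2]
    simp
  have hle : ∫ x', |z x'| ∂μ ≤ ‖onesFun μ‖ * ‖z‖ := by
    rw [hint]
    refine (real_inner_le_norm _ _).trans ?_
    rw [norm_abs_eq_norm]
  have h0 : 0 ≤ ∫ x', |z x'| ∂μ := integral_nonneg fun _ => abs_nonneg _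
  unfold consensusMajorant
  refine (norm_add_le _ _).trans ?_
  rw [norm_smul, norm_smul, norm_abs_eq_norm, Real.norm_of_nonneg (by positivity),
    Real.norm_of_nonneg (by positivity)]
  have := mul_le_mul_of_nonneg_left hle (mul_nonneg (norm_nonneg σ) (norm_nonneg (onesFun μ)))
  nlinarith [this]

/-- The bounded operator `A` of `L²`, `(A z)(x) = ∫ σ(x, x') (z(x') - z(x)) dx'` for a.e. `x`. -/
def consensusOp (σ : Lp ℝ ∞ (μ.prod μ)) : Lp ℝ 2 μ →L[ℝ] Lp ℝ 2 μ :=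
  LinearMap.mkContinuous
    { toFun := fun z => (consensusFun_memLp σ z).toLp (consensusFun σ z)
      map_add' := fun z w => by
        rw [← MemLp.toLp_add]
        exact MemLp.toLp_congr _ _ (consensusFun_add σ z w)
      map_smul' := fun c z => by
        rw [RingHom.id_apply, ← MemLp.toLp_const_smul]
        exact MemLp.toLp_congr _ _ (consensusFun_smul σ c z) }
    (‖σ‖ * ‖onesFun μ‖ ^ 2 + ‖σ‖ * μ.real univ)
    (fun z => by
      refine le_trans (Lp.norm_le_norm_of_ae_le ?_) (norm_consensusMajorant_le σ z)
      filter_upwards [(consensusFun_memLp σ z).coeFn_toLp, consensusFun_le σ z] with x h1 h2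
      exact (congrArg norm h1).le.trans h2)

lemma consensusOp_coe (σ : Lp ℝ ∞ (μ.prod μ)) (z : Lp ℝ 2 μ) :
    consensusOp σ z =ᵐ[μ] fun x => ∫ x', σ (x, x') * (z x' - z x) ∂μ :=
  (consensusFun_memLp σ z).coeFn_toLp

end Kernel

/-! ### Infinite dimension: the directed graph of a bounded kernel -/

/-- A nonempty bounded open subset of `ℝ^d`. -/
structure BoundedOpen (d : ℕ) where
  carrier : Set (EuclideanSpace ℝ (Fin d))
  isOpen : IsOpen carrier
  isBounded : Bornology.IsBounded carrier
  nonempty : carrier.Nonempty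

variable {d : ℕ}

/-- Lebesgue measure on `Ω`. -/
def BoundedOpen.measure (Ω : BoundedOpen d) : Measure (EuclideanSpace ℝ (Fin d)) :=
  volume.restrict Ω.carrier

instance (Ω : BoundedOpen d) : IsFiniteMeasure Ω.measure :=
  ⟨by
    rw [BoundedOpen.measure, Measure.restrict_apply_univ]
    exact Ω.isBounded.measure_lt_top⟩

variable {Ω : BoundedOpen d}

/-- `g ∈ L¹(Ω)` is the value at `x` of the map `x' ↦ σ(x', ·) ∈ L¹(Ω)` in the sense of Lebesgue
points: the mean of `‖σ(x', ·) - g‖_{L¹}` over `x'` in the ball of radius `r` around `x` tends to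
`0` as `r → 0`. Such a `g` is unique, and depends only on the class of `σ`. -/
def IsSectionAt (σ : Lp ℝ ∞ (Ω.measure.prod Ω.measure)) (x : EuclideanSpace ℝ (Fin d))
    (g : Lp ℝ 1 Ω.measure) : Prop :=
  Tendsto (fun r : ℝ =>
      (∫⁻ x' in Metric.ball x r, (∫⁻ y, ‖σ (x', y) - g y‖ₑ ∂Ω.measure) ∂Ω.measure) /
        Ω.measure (Metric.ball x r))
    (𝓝[>] 0) (𝓝 0)

/-- Lebesgue points of `σ`: the points `x` of `Ω` at which the section `σ(x, ·)` is defined almost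
everywhere, as an element of `L¹(Ω)`. -/
def IsLebesguePoint (σ : Lp ℝ ∞ (Ω.measure.prod Ω.measure)) (x : EuclideanSpace ℝ (Fin d)) :
    Prop :=
  x ∈ Ω.carrier ∧ ∃ g : Lp ℝ 1 Ω.measure, IsSectionAt σ x g

/-- The (measure-theoretic) essential support of `g`: the points of `Ω` at which `{g ≠ 0}` does not
have density zero. It coincides with `{g ≠ 0}` up to a null set and depends only on the class
of `g`. -/
def essSupport (g : Lp ℝ 1 Ω.measure) : Set (EuclideanSpace ℝ (Fin d)) :=
  {x | x ∈ Ω.carrier ∧ ¬ Tendsto (fun r : ℝ =>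
      Ω.measure ({y | g y ≠ 0} ∩ Metric.ball x r) / Ω.measure (Metric.ball x r))
    (𝓝[>] 0) (𝓝 0)}

/-- The directed graph of `σ`: the vertices are the Lebesgue points of `σ`, and there is an arc from
`x₁` to `x₂ ≠ x₁` when `x₂` is in the essential support of `σ(x₁, ·)`. -/
def kernelGraph (σ : Lp ℝ ∞ (Ω.measure.prod Ω.measure)) :
    Digraph {x : EuclideanSpace ℝ (Fin d) // IsLebesguePoint σ x} where
  Adj x₁ x₂ := x₁ ≠ x₂ ∧ ∃ g : Lp ℝ 1 Ω.measure, IsSectionAt σ x₁ g ∧ x₂.1 ∈ essSupport g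

/-- Strong connectivity for a kernel: any two distinct vertices are joined by a path, and
`ess inf S > 0`. -/
def IsStronglyConnectedKernel (σ : Lp ℝ ∞ (Ω.measure.prod Ω.measure)) : Prop :=
  IsConnectedByPaths (kernelGraph σ) ∧ 0 < essInf (totalInfluence σ) Ω.measure

end Consensus

end

/-!
The condition `A* v = 0` says that `v` is *stationary*: at each point `y` the inflow
`∫ σ(x, y) v(x) dx` equals the outflow `S(y) v(y)`, where `S(y) = ∫ σ(y, x) dx`. The weighted mean
is then conserved, because `⟨y(t), v⟩` has derivative `⟨A y(t), v⟩ = ⟨y(t), A* v⟩ = 0`. Existence and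
uniqueness of `v` form a Perron-Frobenius theorem, resting on three facts.

* A nonzero stationary `v` exists. For matrices this is the singularity of `A`, as `A e = 0`. For
  kernels, `ker A*` is the orthogonal complement of the range of `A`, and this range is not dense: if
  `A z = S + r` with `r` small, then the average `w = (∫ σ(·, y) z(y) dy) / S` of `z` is bounded
  and equal to `z + 1 + r / S`; averaging again gives `w ≤ sup w - 1/2`, which is absurd
  (`IsBoundedKernel.not_consensus_eq_outflow_add`). Here `S` has to be bounded below.
* If `v` is stationary, so is `|v|`: the triangle inequality gives `S |v| ≤ ∫ σ(x, ·) |v(x)| dx`, and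
  both sides have the same integral (`stationary_abs`, `IsBoundedKernel.isStationary_abs`).
* If `v ≥ 0` is stationary and nonzero, then `v > 0`: no mass moves from `{v > 0}` to `{v = 0}`, and
  strong connectivity excludes such a set (`stationary_pos`,
  `IsBoundedKernel.pos_of_isStationary`).

So `|v|` is positive after the second and third facts, and can be normalized. The difference `h` of
two normalized solutions has mean zero, and its positive part is stationary, hence zero or positive;
in both cases `h = 0`.

For kernels, strong connectivity is a statement about Lebesgue points, and it has to be turned into
irreducibility in the sense of measure theory (`isIrreducible_of_isConnectedByPaths`). Suppose that
`σ = 0` almost everywhere on `B × Bᶜ`. If `B` does not have density zero at a Lebesgue point `x`, then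
`σ(x, ·)` vanishes almost everywhere on `Bᶜ`, because the mean of `‖σ(x', ·) - σ(x, ·)‖` over small
balls is at least the fraction of the ball occupied by `B` times `∫ |σ(x, y)| dy` over `Bᶜ`. Hence `B`
does not have density zero at any point of the essential support of `σ(x, ·)` either. A path starting
at a density point of `B` thus never reaches a density point of `Bᶜ`. As almost every point is a
Lebesgue point, one of the two sets is null.
-/

namespace Consensus

/-! ### Conservation of the weighted mean -/

/-- If `A* v = 0` then `⟨y(t), v⟩` has derivative `⟨A y(t), v⟩ = ⟨y(t), A* v⟩ = 0`. -/
lemma IsSolution.weightedMean_eq {X : Type*} [NormedAddCommGroup X] [InnerProductSpace ℝ X]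
    [CompleteSpace X] {A : X →L[ℝ] X} {y : ℝ → X} (hy : IsSolution A y) {v : X}
    (hv : ContinuousLinearMap.adjoint A v = 0) (e : X) {s t : ℝ} (hs : 0 ≤ s) (ht : 0 ≤ t) :
    weightedMean e v (y s) = weightedMean e v (y t) := by
  have hd : ∀ r ∈ Ici (0 : ℝ), HasDerivWithinAt (fun r => inner ℝ (y r) v) 0 (Ici 0) r := by
    intro r hr
    have h := (hy r hr).inner ℝ (hasDerivWithinAt_const r (Ici 0) v)
    rwa [inner_zero_right, zero_add, ← ContinuousLinearMap.adjoint_inner_right, hv,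
      inner_zero_right] at h
  have hc : inner ℝ (y s) v = inner ℝ (y t) v := by
    refine (convex_Ici (0 : ℝ)).is_const_of_fderivWithin_eq_zero (𝕜 := ℝ)
      (f := fun r => inner ℝ (y r) v) (fun r hr => (hd r hr).differentiableWithinAt) ?_ hs ht
    intro r hr
    rw [(hd r hr).hasFDerivWithinAt.fderivWithin (uniqueDiffOn_Ici 0 r hr)]
    simp
  rw [weightedMean, weightedMean, hc]

/-! ### Finite dimension -/

section Finite

variable {N : ℕ} {σ : Matrix (Fin N) (Fin N) ℝ}

lemma adjoint_consensusMatrixOp_eq_zero_iff (v : EuclideanSpace ℝ (Fin N)) :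
    ContinuousLinearMap.adjoint (consensusMatrixOp σ) v = 0 ↔
      ∀ j, ∑ i, σ i j * v i = (∑ k, σ j k) * v j := by
  have h : ContinuousLinearMap.adjoint (consensusMatrixOp σ) v =
      WithLp.toLp 2 (Matrix.mulVec (consensusMatrix σ).transpose v.ofLp) := by
    rw [← ContinuousLinearMap.star_eq_adjoint, consensusMatrixOp, ← map_star]
    rfl
  rw [h, WithLp.toLp_eq_zero, funext_iff]
  refine forall_congr' fun j => ?_
  rw [consensusMatrix, Matrix.transpose_sub, Matrix.sub_mulVec, Matrix.diagonal_transpose,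
    Pi.sub_apply, Matrix.mulVec_diagonal, Pi.zero_apply, sub_eq_zero]
  rfl

/-- Each inequality `S |v| ≤ σᵀ |v|` is an equality, since both sides have the same sum. The
diagonal of `σ`, which may be negative, contributes equally to both sides. -/
lemma stationary_abs (hσ : ∀ i j, i ≠ j → 0 ≤ σ i j) {v : Fin N → ℝ}
    (hv : ∀ j, ∑ i, σ i j * v i = (∑ k, σ j k) * v j) (j : Fin N) :
    ∑ i, σ i j * |v i| = (∑ k, σ j k) * |v j| := by
  have hle : ∀ j, (∑ k, σ j k) * |v j| ≤ ∑ i, σ i j * |v i| := by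
    intro j
    have hS : 0 ≤ (∑ k, σ j k) - σ j j := by
      rw [← Finset.add_sum_erase _ _ (Finset.mem_univ j), add_sub_cancel_left]
      exact Finset.sum_nonneg fun k hk => hσ _ _ (Finset.ne_of_mem_erase hk).symm
    have h1 : ((∑ k, σ j k) - σ j j) * v j = ∑ i ∈ Finset.univ.erase j, σ i j * v i := by
      rw [sub_mul, ← hv j, ← Finset.add_sum_erase _ _ (Finset.mem_univ j), add_sub_cancel_left]
    have h2 : ((∑ k, σ j k) - σ j j) * |v j| ≤ ∑ i ∈ Finset.univ.erase j, σ i j * |v i| := by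
      rw [← abs_of_nonneg hS, ← abs_mul, h1]
      refine (Finset.abs_sum_le_sum_abs _ _).trans (Finset.sum_le_sum fun i hi => ?_)
      rw [abs_mul, abs_of_nonneg (hσ _ _ (Finset.ne_of_mem_erase hi))]
    rw [← Finset.add_sum_erase _ (fun i => σ i j * |v i|) (Finset.mem_univ j)]
    linarith
  have hsum : ∑ j, (∑ k, σ j k) * |v j| = ∑ j, ∑ i, σ i j * |v i| := by
    rw [Finset.sum_comm]
    exact Finset.sum_congr rfl fun j _ => Finset.sum_mul _ _ _
  exact ((Finset.sum_eq_sum_iff_of_le fun j _ => hle j).1 hsum j (Finset.mem_univ j)).symm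

/-- Positivity propagates along the edges of the graph. -/
lemma stationary_pos (hσ : ∀ i j, i ≠ j → 0 ≤ σ i j) (hG : IsConnectedByPaths (matrixGraph σ))
    {v : Fin N → ℝ} (hv : ∀ j, ∑ i, σ i j * v i = (∑ k, σ j k) * v j) (h0 : ∀ i, 0 ≤ v i)
    (hne : v ≠ 0) (j : Fin N) : 0 < v j := by
  obtain ⟨i, hi⟩ := Function.ne_iff.1 hne
  have hi : 0 < v i := (h0 i).lt_of_ne' hi
  rcases eq_or_ne i j with rfl | hij
  · exact hi
  obtain ⟨r, -, p, hp, rfl, rfl, hadj⟩ := hG i j hij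
  suffices ∀ k, 0 < v (p k) from this _
  intro k
  induction k using Fin.induction with
  | zero => exact hi
  | succ k ih =>
    refine (h0 _).lt_of_ne' fun hz => ?_
    have hsum := hv (p k.succ)
    rw [hz, mul_zero, Finset.sum_eq_zero_iff_of_nonneg] at hsum
    · exact (mul_pos (hadj k) ih).ne' (hsum _ (Finset.mem_univ _))
    · intro i _
      rcases eq_or_ne i (p k.succ) with rfl | hne
      · rw [hz, mul_zero]
      · exact mul_nonneg (hσ _ _ hne) (h0 i)

/-- The matrix `A` is singular because `A e = 0`, so `A*` is singular as well. -/
lemma exists_stationary (hN : 1 ≤ N) (σ : Matrix (Fin N) (Fin N) ℝ) :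
    ∃ v : Fin N → ℝ, v ≠ 0 ∧ ∀ j, ∑ i, σ i j * v i = (∑ k, σ j k) * v j := by
  have hdet : (consensusMatrix σ).det = 0 := by
    refine Matrix.exists_mulVec_eq_zero_iff.1 ⟨fun _ => 1, ?_, ?_⟩
    · exact Function.ne_iff.2 ⟨⟨0, hN⟩, one_ne_zero⟩
    · ext i
      rw [consensusMatrix, Matrix.sub_mulVec, Pi.sub_apply, Matrix.mulVec_diagonal]
      simp [Matrix.mulVec, dotProduct]
  obtain ⟨v, hv0, hv⟩ := Matrix.exists_vecMul_eq_zero_iff.2 hdet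
  refine ⟨v, hv0, fun j => ?_⟩
  have h := congrFun hv j
  rw [consensusMatrix, Matrix.vecMul_sub, Pi.sub_apply, Matrix.vecMul_diagonal, Pi.zero_apply,
    sub_eq_zero, mul_comm (v j)] at h
  rw [← h]
  exact Finset.sum_congr rfl fun i _ => mul_comm _ _

lemma inner_onesVec (v : EuclideanSpace ℝ (Fin N)) : inner ℝ v (onesVec N) = ∑ i, v i := by
  simp [PiLp.inner_apply, onesVec]

/-- A stationary vector of mean zero vanishes: otherwise its positive part `(|v| + v) / 2` would be
stationary and neither zero nor positive. -/
lemma stationary_eq_zero (hσ : ∀ i j, i ≠ j → 0 ≤ σ i j)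
    (hG : IsConnectedByPaths (matrixGraph σ))
    {v : Fin N → ℝ} (hv : ∀ j, ∑ i, σ i j * v i = (∑ k, σ j k) * v j)
    (h0 : ∑ i, v i = 0) : v = 0 := by
  by_contra hne
  obtain ⟨i, -, hi⟩ := Finset.exists_ne_zero_of_sum_ne_zero (s := Finset.univ) (f := fun i => |v i|)
    fun h => hne <| funext fun i => abs_eq_zero.1 <|
      (Finset.sum_eq_zero_iff_of_nonneg fun i _ => abs_nonneg _).1 h i (Finset.mem_univ i)
  have hpos : ∀ j, 0 < |v j| + v j := by
    refine stationary_pos hσ hG (v := fun j => |v j| + v j) (fun j => ?_)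
      (fun j => by linarith [neg_abs_le (v j)]) fun h => ?_
    · simp only [mul_add, Finset.sum_add_distrib]
      rw [hv, stationary_abs hσ hv]
    · have hle : ∀ j ∈ Finset.univ, v j ≤ 0 := fun j _ => by
        have := congrFun h j
        simp only [Pi.zero_apply] at this
        linarith [abs_nonneg (v j)]
      have := (Finset.sum_eq_zero_iff_of_nonpos hle).1 h0 i (Finset.mem_univ i)
      exact hi (by simp [this])
  have hvpos : ∀ j, 0 < v j := fun j => by
    by_contra hj
    have := hpos j
    rw [abs_of_nonpos (not_lt.1 hj)] at this
    linarith
  exact (Finset.sum_pos (fun j _ => hvpos j) ⟨i, Finset.mem_univ i⟩).ne' h0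

end Finite

/-! ### Stationary densities of a bounded kernel -/

section Kernel

variable {α : Type*} [MeasurableSpace α]

/-- `k` is measurable with values in `[0, C]`. Unlike for elements of `L∞`, all bounds hold at every
point. -/
structure IsBoundedKernel (k : α → α → ℝ) (C : ℝ) : Prop where
  measurable : Measurable (Function.uncurry k)
  nonneg : ∀ x y, 0 ≤ k x y
  le : ∀ x y, k x y ≤ C

/-- `v` is invariant for the dynamics with kernel `k`: the mass `∫ k(x, y) v(x) dx` arriving at `y`
equals the mass `S(y) v(y)` leaving it. -/
def IsStationary (μ : Measure α) (k : α → α → ℝ) (v : α → ℝ) : Prop :=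
  ∀ᵐ y ∂μ, ∫ x, k x y * v x ∂μ = (∫ x, k y x ∂μ) * v y

variable {μ : Measure α} {k : α → α → ℝ} {C : ℝ} {v z : α → ℝ}

/-- Every nonnegative element of `L∞` has a representative with pointwise bounds. -/
lemma exists_isBoundedKernel [IsFiniteMeasure μ] (σ : Lp ℝ ∞ (μ.prod μ))
    (hσ : ∀ᵐ p ∂(μ.prod μ), 0 ≤ σ p) :
    ∃ (k : α → α → ℝ) (C : ℝ), IsBoundedKernel k C ∧
      ∀ᵐ x ∂μ, ∀ᵐ y ∂μ, σ (x, y) = k x y := by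
  refine ⟨fun x y => max 0 (min (σ (x, y)) ‖σ‖), ‖σ‖, ⟨?_, ?_, ?_⟩, ?_⟩
  · exact measurable_const.max ((Lp.stronglyMeasurable σ).measurable.min measurable_const)
  · exact fun x y => le_max_left _ _
  · exact fun x y => max_le (norm_nonneg _) (min_le_right _ _)
  · filter_upwards [kernel_ae_bound σ, Measure.ae_ae_of_ae_prod hσ] with x h1 h2
    filter_upwards [h1, h2] with y h3 h4
    rw [min_eq_left ((le_abs_self _).trans h3), max_eq_right h4]

namespace IsBoundedKernel

lemma norm_le (hk : IsBoundedKernel k C) (x y : α) : ‖k x y‖ ≤ C := by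
  rw [Real.norm_of_nonneg (hk.nonneg x y)]
  exact hk.le x y

lemma measurable_left (hk : IsBoundedKernel k C) (x : α) : Measurable (k x) :=
  hk.measurable.comp measurable_prodMk_left

lemma measurable_right (hk : IsBoundedKernel k C) (y : α) : Measurable fun x => k x y :=
  hk.measurable.comp measurable_prodMk_right

lemma integrable_left_mul (hk : IsBoundedKernel k C) (x : α) (hz : Integrable z μ) :
    Integrable (fun y => k x y * z y) μ :=
  hz.bdd_mul (hk.measurable_left x).aestronglyMeasurable (ae_of_all _ (hk.norm_le x))

lemma integrable_right_mul (hk : IsBoundedKernel k C) (y : α) (hv : Integrable v μ) :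
    Integrable (fun x => k x y * v x) μ :=
  hv.bdd_mul (hk.measurable_right y).aestronglyMeasurable
    (ae_of_all _ fun x => hk.norm_le x y)

lemma integrable_prod_mul (hk : IsBoundedKernel k C) {f : α × α → ℝ}
    (hf : Integrable f (μ.prod μ)) :
    Integrable (fun p : α × α => k p.1 p.2 * f p) (μ.prod μ) :=
  hf.bdd_mul hk.measurable.aestronglyMeasurable (ae_of_all _ fun p => hk.norm_le p.1 p.2)

lemma outflow_nonneg (hk : IsBoundedKernel k C) (x : α) : 0 ≤ ∫ y, k x y ∂μ :=
  integral_nonneg (hk.nonneg x)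

lemma norm_integral_left_mul_le (hk : IsBoundedKernel k C) (x : α) (hz : Integrable z μ) :
    ‖∫ y, k x y * z y ∂μ‖ ≤ C * ∫ y, |z y| ∂μ := by
  rw [← integral_const_mul]
  refine norm_integral_le_of_norm_le (hz.abs.const_mul C) (ae_of_all _ fun y => ?_)
  rw [norm_mul, Real.norm_eq_abs (z y)]
  exact mul_le_mul_of_nonneg_right (hk.norm_le x y) (abs_nonneg _)

variable [IsFiniteMeasure μ]

lemma integrable_left (hk : IsBoundedKernel k C) (x : α) : Integrable (k x) μ := by
  simpa using hk.integrable_left_mul x (integrable_const (1 : ℝ))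

lemma outflow_norm_le (hk : IsBoundedKernel k C) (x : α) : ‖∫ y, k x y ∂μ‖ ≤ C * μ.real univ :=
  norm_integral_le_of_norm_le_const (ae_of_all _ (hk.norm_le x))

lemma stronglyMeasurable_outflow (hk : IsBoundedKernel k C) :
    StronglyMeasurable fun x => ∫ y, k x y ∂μ :=
  hk.measurable.stronglyMeasurable.integral_prod_right'

/-- The inflow minus the outflow of an `L²` density is again in `L²`. -/
lemma memLp_inflow_sub_outflow (hk : IsBoundedKernel k C) (hv : MemLp v 2 μ) :
    MemLp (fun y => ∫ x, k x y * v x ∂μ - (∫ x, k y x ∂μ) * v y) 2 μ := by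
  have hvi : Integrable v μ := hv.integrable (by norm_num)
  refine MemLp.sub ?_ ?_
  · refine MemLp.of_bound (C := C * ∫ x, |v x| ∂μ) ?_ (ae_of_all _ fun y => ?_)
    · refine AEStronglyMeasurable.integral_prod_right' (f := fun p : α × α => k p.2 p.1 * v p.2) ?_
      exact (hk.measurable.comp measurable_swap).aestronglyMeasurable.mul hvi.1.comp_snd
    · rw [← integral_const_mul]
      refine norm_integral_le_of_norm_le (hvi.abs.const_mul C) (ae_of_all _ fun x => ?_)
      rw [norm_mul, Real.norm_eq_abs (v x)]
      exact mul_le_mul_of_nonneg_right (hk.norm_le x y) (abs_nonneg _)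
  · refine (hv.const_mul (C * μ.real univ)).of_le
      (hk.stronglyMeasurable_outflow.aestronglyMeasurable.mul hv.1) (ae_of_all _ fun y => ?_)
    rw [norm_mul, norm_mul]
    exact mul_le_mul_of_nonneg_right ((hk.outflow_norm_le y).trans (le_abs_self _))
      (norm_nonneg _)

/-- Duality between the operator `A` and the balance of inflow and outflow. -/
lemma integral_mul_consensus (hk : IsBoundedKernel k C) (hv : MemLp v 2 μ) (hz : MemLp z 2 μ) :
    ∫ x, v x * (∫ y, k x y * z y ∂μ - (∫ y, k x y ∂μ) * z x) ∂μ =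
      ∫ y, (∫ x, k x y * v x ∂μ - (∫ x, k y x ∂μ) * v y) * z y ∂μ := by
  have hvi : Integrable v μ := hv.integrable (by norm_num)
  have hzi : Integrable z μ := hz.integrable (by norm_num)
  have hvz : Integrable (fun x => v x * z x) μ := hv.integrable_mul hz
  have h1 := hk.integrable_prod_mul (hvi.mul_prod hzi)
  have hS : Integrable (fun x => (∫ y, k x y ∂μ) * (v x * z x)) μ :=
    hvz.bdd_mul hk.stronglyMeasurable_outflow.aestronglyMeasurable
      (ae_of_all _ hk.outflow_norm_le)
  have hl := h1.integral_prod_left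
  have hr := h1.integral_prod_right
  calc _ = ∫ x, ((∫ y, k x y * (v x * z y) ∂μ) - (∫ y, k x y ∂μ) * (v x * z x)) ∂μ := by
        refine integral_congr_ae (ae_of_all _ fun x => ?_)
        have : ∫ y, k x y * (v x * z y) ∂μ = v x * ∫ y, k x y * z y ∂μ := by
          rw [← integral_const_mul]
          congr 1; ext y; ring
        simp only [this]
        ring
    _ = ∫ y, ((∫ x, k x y * (v x * z y) ∂μ) - (∫ x, k y x ∂μ) * (v y * z y)) ∂μ := by
        rw [integral_sub hl hS, integral_sub hr hS]
        congr 1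
        exact integral_integral_swap h1
    _ = _ := by
        refine integral_congr_ae (ae_of_all _ fun y => ?_)
        have : ∫ x, k x y * (v x * z y) ∂μ = (∫ x, k x y * v x ∂μ) * z y := by
          rw [← integral_mul_const]
          congr 1; ext x; ring
        simp only [this]
        ring

/-- The inequality `S |v| ≤ ∫ k(x, ·) |v(x)| dx` is an equality almost everywhere, since both sides
have the same integral. -/
lemma isStationary_abs (hk : IsBoundedKernel k C) (hvi : Integrable v μ)
    (hv : IsStationary μ k v) : IsStationary μ k fun x => |v x| := by
  have hle : ∀ᵐ y ∂μ, (∫ x, k y x ∂μ) * |v y| ≤ ∫ x, k x y * |v x| ∂μ := by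
    filter_upwards [hv] with y hy
    rw [← abs_of_nonneg (hk.outflow_nonneg y), ← abs_mul, ← hy]
    refine abs_integral_le_integral_abs.trans_eq (integral_congr_ae (ae_of_all _ fun x => ?_))
    simp only [abs_mul, abs_of_nonneg (hk.nonneg x y)]
  have h1 := hk.integrable_prod_mul (hvi.abs.comp_fst μ)
  have hS : Integrable (fun x => (∫ y, k x y ∂μ) * |v x|) μ :=
    hvi.abs.bdd_mul hk.stronglyMeasurable_outflow.aestronglyMeasurable
      (ae_of_all _ hk.outflow_norm_le)
  have heq : ∫ y, (∫ x, k y x ∂μ) * |v y| ∂μ = ∫ y, ∫ x, k x y * |v x| ∂μ ∂μ := by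
    rw [← integral_integral_swap h1]
    exact integral_congr_ae (ae_of_all _ fun x => (integral_mul_const _ _).symm)
  filter_upwards [(integral_eq_iff_of_ae_le hS h1.integral_prod_right hle).1 heq] with y hy
  exact hy.symm

end IsBoundedKernel

/-- The kernel `k` does not let any set of positive measure with complement of positive measure
evolve in isolation. -/
def IsIrreducible (μ : Measure α) (k : α → α → ℝ) : Prop :=
  ∀ B : Set α, MeasurableSet B → (∀ᵐ x ∂μ, ∀ᵐ y ∂μ, x ∈ B → y ∉ B → k x y = 0) →
    μ B = 0 ∨ μ Bᶜ = 0

namespace IsBoundedKernel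

variable [IsFiniteMeasure μ]

/-- If `v` is stationary and nonnegative, then `k` vanishes on `{v > 0} × {v = 0}`. -/
lemma pos_of_isStationary (hk : IsBoundedKernel k C) (hirr : IsIrreducible μ k)
    (hvi : Integrable v μ) (hvm : Measurable v) (hv : IsStationary μ k v)
    (h0 : ∀ᵐ x ∂μ, 0 ≤ v x) (hne : ¬ v =ᵐ[μ] 0) : ∀ᵐ x ∂μ, 0 < v x := by
  have hB : MeasurableSet {x | 0 < v x} := measurableSet_lt measurable_const hvm
  have key : ∀ᵐ y ∂μ, ∀ᵐ x ∂μ, x ∈ {x | 0 < v x} → y ∉ {x | 0 < v x} → k x y = 0 := by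
    filter_upwards [hv, h0] with y hy hy0
    by_cases hpos : 0 < v y
    · exact ae_of_all _ fun x _ h => absurd hpos h
    rw [le_antisymm (not_lt.1 hpos) hy0, mul_zero,
      integral_eq_zero_iff_of_nonneg_ae (h0.mono fun x hx => mul_nonneg (hk.nonneg x y) hx)
        (hk.integrable_right_mul y hvi)] at hy
    filter_upwards [hy] with x hx hxB _
    exact (mul_eq_zero.1 hx).resolve_right hxB.ne'
  have hmeas : MeasurableSet {p : α × α | p.1 ∈ {x | 0 < v x} → p.2 ∉ {x | 0 < v x} →
      k p.1 p.2 = 0} := by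
    have h1 : MeasurableSet {p : α × α | p.1 ∈ {x | 0 < v x}} := measurable_fst hB
    have h2 : MeasurableSet {p : α × α | p.2 ∉ {x | 0 < v x}} := measurable_snd hB.compl
    have h3 : MeasurableSet {p : α × α | k p.1 p.2 = 0} :=
      hk.measurable (measurableSet_singleton 0)
    exact h1.imp (h2.imp h3)
  rcases hirr _ hB ((Measure.ae_ae_comm hmeas).2 key) with h | h
  · refine absurd ?_ hne
    have : ∀ᵐ x ∂μ, ¬ 0 < v x := measure_eq_zero_iff_ae_notMem.1 h
    filter_upwards [this, h0] with x hx hx0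
    exact le_antisymm (not_lt.1 hx) hx0
  · exact h

lemma stationary_ae_eq_zero (hk : IsBoundedKernel k C) (hirr : IsIrreducible μ k)
    (hvi : Integrable v μ) (hvm : Measurable v) (hv : IsStationary μ k v)
    (h0 : ∫ x, v x ∂μ = 0) : v =ᵐ[μ] 0 := by
  by_cases hz : (fun x => |v x| + v x) =ᵐ[μ] 0
  · have hle : ∀ᵐ x ∂μ, 0 ≤ -v x := by
      filter_upwards [hz] with x hx
      simp only [Pi.zero_apply] at hx
      linarith [abs_nonneg (v x)]
    have h1 : ∫ x, -v x ∂μ = 0 := by rw [integral_neg, h0, neg_zero]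
    filter_upwards [(integral_eq_zero_iff_of_nonneg_ae hle hvi.neg).1 h1] with x hx
    simpa using hx
  · have hpos : ∀ᵐ x ∂μ, 0 < |v x| + v x := by
      refine hk.pos_of_isStationary hirr (hvi.abs.add hvi) (hvm.abs.add hvm) ?_
        (ae_of_all _ fun x => by linarith [neg_abs_le (v x)]) hz
      filter_upwards [hv, hk.isStationary_abs hvi hv] with y h1 h2
      simp only [mul_add]
      rw [integral_add (hk.integrable_right_mul y hvi.abs) (hk.integrable_right_mul y hvi), h1, h2]
    have hle : ∀ᵐ x ∂μ, 0 ≤ v x := by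
      filter_upwards [hpos] with x hx
      by_contra h
      rw [abs_of_neg (not_le.1 h)] at hx
      linarith
    exact (integral_eq_zero_iff_of_nonneg_ae hle hvi).1 h0

/-- A maximum principle: `A z = S + r` is impossible if `r` is small in `L¹`. Indeed the average
`w = (∫ k(·, y) z(y) dy) / S` is bounded and satisfies `w = z + 1 + r / S`, and averaging this
identity once more gives `w ≤ sup w - 1/2`. -/
lemma not_consensus_eq_outflow_add (hk : IsBoundedKernel k C) [NeZero μ] {δ : ℝ} (hδ : 0 < δ)
    (hS : ∀ᵐ x ∂μ, δ ≤ ∫ y, k x y ∂μ) (hzi : Integrable z μ) {r : α → ℝ} (hr : Integrable r μ)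
    (hsmall : C * ∫ x, |r x| ∂μ ≤ δ ^ 2 / 2)
    (h : ∀ᵐ x ∂μ, ∫ y, k x y * z y ∂μ - (∫ y, k x y ∂μ) * z x = (∫ y, k x y ∂μ) + r x) :
    False := by
  set S : α → ℝ := fun x => ∫ y, k x y ∂μ with hSdef
  have hSm : StronglyMeasurable S := hk.stronglyMeasurable_outflow
  set w : α → ℝ := fun x => (∫ y, k x y * z y ∂μ) / S x with hw
  have hwz : ∀ᵐ x ∂μ, w x = z x + 1 + r x / S x := by
    filter_upwards [h, hS] with x hx hxS
    have : S x ≠ 0 := (hδ.trans_le hxS).ne'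
    simp only [hw]
    field_simp
    linarith
  have hrS : Integrable (fun x => r x / S x) μ := by
    simp only [div_eq_inv_mul]
    refine hr.bdd_mul (c := δ⁻¹) hSm.measurable.inv.aestronglyMeasurable ?_
    filter_upwards [hS] with x hxS
    rw [norm_inv, Real.norm_of_nonneg (hδ.le.trans hxS)]
    exact inv_anti₀ hδ hxS
  have hC : 0 ≤ C := by
    obtain ⟨x, -⟩ := hS.exists
    exact (hk.nonneg x x).trans (hk.le x x)
  have hbound : ∀ᵐ x ∂μ, |w x| ≤ C * (∫ y, |z y| ∂μ) / δ := by
    filter_upwards [hS] with x hxS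
    rw [hw, abs_div, abs_of_nonneg (hδ.le.trans hxS)]
    exact div_le_div₀ (mul_nonneg hC (integral_nonneg fun _ => abs_nonneg _))
      (hk.norm_integral_left_mul_le x hzi) hδ hxS
  have hrS_small : C * ∫ x, |r x / S x| ∂μ ≤ δ / 2 := by
    have : ∫ x, |r x / S x| ∂μ ≤ (∫ x, |r x| ∂μ) / δ := by
      rw [← integral_div]
      refine integral_mono_ae hrS.abs (hr.abs.div_const δ) ?_
      filter_upwards [hS] with x hxS
      rw [abs_div, abs_of_nonneg (hδ.le.trans hxS)]
      exact div_le_div_of_nonneg_left (abs_nonneg _) hδ hxS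
    calc C * ∫ x, |r x / S x| ∂μ ≤ C * ((∫ x, |r x| ∂μ) / δ) := by gcongr
      _ = (C * ∫ x, |r x| ∂μ) / δ := by ring
      _ ≤ (δ ^ 2 / 2) / δ := by gcongr
      _ = δ / 2 := by field_simp
  have hstep : ∀ M : ℝ, (∀ᵐ x ∂μ, w x ≤ M) → ∀ᵐ x ∂μ, w x ≤ M - 1 / 2 := by
    intro M hM
    filter_upwards [hS] with x hxS
    have hSpos : 0 < S x := hδ.trans_le hxS
    have h1 : ∫ y, k x y * z y ∂μ ≤ ∫ y, (k x y * (M - 1) - k x y * (r y / S y)) ∂μ := by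
      refine integral_mono_ae (hk.integrable_left_mul x hzi)
        (((hk.integrable_left x).mul_const _).sub (hk.integrable_left_mul x hrS)) ?_
      filter_upwards [hM, hwz] with y h2 h3
      rw [← mul_sub]
      exact mul_le_mul_of_nonneg_left (by linarith) (hk.nonneg x y)
    rw [integral_sub ((hk.integrable_left x).mul_const _) (hk.integrable_left_mul x hrS),
      integral_mul_const] at h1
    have h2 := neg_le_of_abs_le ((hk.norm_integral_left_mul_le x hrS).trans hrS_small)
    rw [hw, div_le_iff₀ hSpos]
    have h3 : (M - 1 / 2) * S x = S x * (M - 1) + S x / 2 := by ring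
    rw [h3]
    linarith
  have hiter : ∀ n : ℕ, ∀ᵐ x ∂μ, w x ≤ C * (∫ y, |z y| ∂μ) / δ - n / 2 := by
    intro n
    induction n with
    | zero => filter_upwards [hbound] with x hx; simpa using (le_abs_self _).trans hx
    | succ n ih =>
      filter_upwards [hstep _ ih] with x hx
      push_cast
      linarith
  obtain ⟨n, hn⟩ := exists_nat_gt (4 * (C * (∫ y, |z y| ∂μ) / δ))
  obtain ⟨x, hx1, hx2⟩ := ((hiter n).and hbound).exists
  linarith [neg_le_of_abs_le hx2]

end IsBoundedKernel

end Kernel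

/-! ### Lebesgue points and density -/

lemma measurable_of_measurableSet_edist_lt {α E : Type*} [MeasurableSpace α]
    [PseudoEMetricSpace E] [SecondCountableTopology E] [MeasurableSpace E] [BorelSpace E]
    {F : α → E} (hF : ∀ (g : E) (ε : ℝ≥0∞), MeasurableSet {x | edist (F x) g < ε}) :
    Measurable F := by
  refine measurable_of_isOpen fun U hU => ?_
  have hball : ∀ g ∈ U, ∃ ε > 0, Metric.eball g ε ⊆ U := EMetric.isOpen_iff.1 hU
  choose! ε hε hsub using hball
  obtain ⟨t, htU, htc, hcov⟩ := TopologicalSpace.countable_cover_nhdsWithin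
    (f := fun g => Metric.eball g (ε g)) (s := U)
    fun g hg => mem_nhdsWithin_of_mem_nhds (Metric.eball_mem_nhds g (hε g hg))
  have hU' : U = ⋃ g ∈ t, Metric.eball g (ε g) :=
    hcov.antisymm (iUnion₂_subset fun g hg => hsub g (htU hg))
  rw [hU', preimage_iUnion₂]
  exact MeasurableSet.biUnion htc fun g _ => hF g (ε g)

lemma IsBoundedKernel.edist_toL1 {α : Type*} [MeasurableSpace α] {μ : Measure α}
    [IsFiniteMeasure μ] {k : α → α → ℝ} {C : ℝ} (hk : IsBoundedKernel k C) (x : α)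
    (g : Lp ℝ 1 μ) :
    edist ((hk.integrable_left (μ := μ) x).toL1 (k x)) g = ∫⁻ y, ‖k x y - g y‖ₑ ∂μ := by
  rw [Lp.edist_def, eLpNorm_one_eq_lintegral_enorm]
  refine lintegral_congr_ae ?_
  filter_upwards [(hk.integrable_left (μ := μ) x).coeFn_toL1] with y hy
  rw [Pi.sub_apply, hy]

variable {d : ℕ} {Ω : BoundedOpen d}

lemma ball_ae_eq_closedBall (x : EuclideanSpace ℝ (Fin d)) {r : ℝ} (hr : r ≠ 0) :
    Metric.ball x r =ᵐ[Ω.measure] Metric.closedBall x r := by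
  have h : ∀ᵐ y ∂Ω.measure, y ∉ Metric.sphere x r :=
    Measure.absolutelyContinuous_of_le Measure.restrict_le_self
      (measure_eq_zero_iff_ae_notMem.1 (Measure.addHaar_sphere_of_ne_zero volume x hr))
  filter_upwards [h] with y hy
  refine propext ⟨fun h => Metric.ball_subset_closedBall h, fun h => ?_⟩
  exact lt_of_le_of_ne h hy

/-- Almost every point is a Lebesgue point: Lebesgue differentiation for the `L¹`-valued map
`x ↦ k(x, ·)`, which is measurable because `L¹` is separable. -/
lemma ae_isSectionAt {σ : Lp ℝ ∞ (Ω.measure.prod Ω.measure)}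
    {k : EuclideanSpace ℝ (Fin d) → EuclideanSpace ℝ (Fin d) → ℝ} {C : ℝ}
    (hk : IsBoundedKernel k C)
    (hσ : ∀ᵐ x ∂Ω.measure, ∀ᵐ y ∂Ω.measure, σ (x, y) = k x y) :
    ∀ᵐ x ∂Ω.measure, ∃ g : Lp ℝ 1 Ω.measure, IsSectionAt σ x g := by
  have : Fact ((1 : ℝ≥0∞) ≠ ∞) := ⟨ENNReal.one_ne_top⟩
  borelize ↥(Lp ℝ 1 Ω.measure)
  set F : EuclideanSpace ℝ (Fin d) → Lp ℝ 1 Ω.measure :=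
    fun x => (hk.integrable_left (μ := Ω.measure) x).toL1 (k x)
  have hFm : Measurable F := measurable_of_measurableSet_edist_lt fun g ε => by
    simp only [F, hk.edist_toL1]
    refine measurableSet_lt (Measurable.lintegral_prod_right' (f := fun p => ‖k p.1 p.2 - g p.2‖ₑ)
      ?_) measurable_const
    exact (hk.measurable.sub ((Lp.stronglyMeasurable g).measurable.comp measurable_snd)).enorm
  have hFi : Integrable F Ω.measure := by
    refine ⟨hFm.aestronglyMeasurable, HasFiniteIntegral.of_bounded (C := C * Ω.measure.real univ)
      (ae_of_all _ fun x => ?_)⟩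
    rw [L1.norm_eq_integral_norm]
    refine (le_abs_self _).trans ?_
    rw [← Real.norm_eq_abs]
    refine norm_integral_le_of_norm_le_const ?_
    filter_upwards [(hk.integrable_left (μ := Ω.measure) x).coeFn_toL1] with y hy
    rw [norm_norm, hy]
    exact hk.norm_le x y
  filter_upwards [(Besicovitch.vitaliFamily Ω.measure).ae_tendsto_lintegral_enorm_sub_div
    hFi.locallyIntegrable] with x hx
  refine ⟨F x, ?_⟩
  refine (hx.comp (Besicovitch.tendsto_filterAt Ω.measure x)).congr' ?_
  filter_upwards [self_mem_nhdsWithin] with r hr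
  have hb := ball_ae_eq_closedBall (Ω := Ω) x (ne_of_gt hr)
  rw [Function.comp_apply, measure_congr hb, Measure.restrict_congr_set hb]
  congr 1
  refine lintegral_congr_ae (ae_restrict_of_ae ?_)
  filter_upwards [hσ] with x' hx'
  rw [← edist_eq_enorm_sub, hk.edist_toL1]
  refine lintegral_congr_ae ?_
  filter_upwards [hx'] with y hy
  rw [hy]

/-- The set `B` has density zero at `x`, relative to `Ω`. -/
def HasDensityZero (Ω : BoundedOpen d) (B : Set (EuclideanSpace ℝ (Fin d)))
    (x : EuclideanSpace ℝ (Fin d)) : Prop :=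
  Tendsto (fun r : ℝ => Ω.measure (B ∩ Metric.ball x r) / Ω.measure (Metric.ball x r))
    (𝓝[>] 0) (𝓝 0)

lemma ae_hasDensityZero_iff {B : Set (EuclideanSpace ℝ (Fin d))} (hB : MeasurableSet B) :
    ∀ᵐ x ∂Ω.measure, HasDensityZero Ω B x ↔ x ∉ B := by
  filter_upwards [Besicovitch.ae_tendsto_measure_inter_div_of_measurableSet Ω.measure hB] with x hx
  have hx' : Tendsto (fun r : ℝ => Ω.measure (B ∩ Metric.ball x r) / Ω.measure (Metric.ball x r))
      (𝓝[>] 0) (𝓝 (B.indicator 1 x)) := by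
    refine hx.congr' ?_
    filter_upwards [self_mem_nhdsWithin] with r hr
    have hb := ball_ae_eq_closedBall (Ω := Ω) x (ne_of_gt hr)
    rw [measure_congr hb, measure_congr ((ae_eq_refl B).inter hb)]
  refine ⟨fun h hxB => ?_, fun hxB => ?_⟩
  · rw [indicator_of_mem hxB] at hx'
    exact one_ne_zero (tendsto_nhds_unique hx' h)
  · rwa [indicator_of_notMem hxB] at hx'

/-- If no mass moves from `B` to its complement, then neither does it from any Lebesgue point at
which `B` does not have density zero. -/
lemma IsSectionAt.ae_eq_zero {σ : Lp ℝ ∞ (Ω.measure.prod Ω.measure)}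
    {B : Set (EuclideanSpace ℝ (Fin d))} (hB : MeasurableSet B)
    (hσ : ∀ᵐ x ∂Ω.measure, ∀ᵐ y ∂Ω.measure, x ∈ B → y ∉ B → σ (x, y) = 0)
    {x : EuclideanSpace ℝ (Fin d)} {g : Lp ℝ 1 Ω.measure} (hg : IsSectionAt σ x g)
    (hx : ¬ HasDensityZero Ω B x) : ∀ᵐ y ∂Ω.measure, y ∉ B → g y = 0 := by
  set c : ℝ≥0∞ := ∫⁻ y in Bᶜ, ‖g y‖ₑ ∂Ω.measure with hc
  have hgm : Measurable fun y => ‖g y‖ₑ := (Lp.stronglyMeasurable g).measurable.enorm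
  by_cases hc0 : c = 0
  · rw [hc, lintegral_eq_zero_iff hgm] at hc0
    filter_upwards [(ae_restrict_iff' hB.compl).1 hc0] with y hy hyB
    simpa using hy hyB
  have hctop : c ≠ ∞ := by
    refine ne_top_of_le_ne_top ?_ (setLIntegral_le_lintegral _ _)
    exact (L1.integrable_coeFn g).2.ne
  refine absurd ?_ hx
  have hlim := ENNReal.Tendsto.div_const hg (b := c) (Or.inr hc0)
  rw [ENNReal.zero_div] at hlim
  refine tendsto_of_tendsto_of_tendsto_of_le_of_le tendsto_const_nhds hlim
    (fun _ => zero_le) fun r => ?_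
  -- On `B` the distance from `σ(x', ·)` to `g` is at least `c`.
  have hle : c * Ω.measure (B ∩ Metric.ball x r) ≤
      ∫⁻ x' in Metric.ball x r, (∫⁻ y, ‖σ (x', y) - g y‖ₑ ∂Ω.measure) ∂Ω.measure := by
    rw [← setLIntegral_const]
    calc _ ≤ ∫⁻ x' in B ∩ Metric.ball x r, (∫⁻ y, ‖σ (x', y) - g y‖ₑ ∂Ω.measure) ∂Ω.measure := by
          refine lintegral_mono_ae ?_
          rw [ae_restrict_iff' (hB.inter measurableSet_ball)]
          filter_upwards [hσ] with x' hx' hx'B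
          refine le_trans ?_ (setLIntegral_le_lintegral Bᶜ _)
          refine lintegral_mono_ae ((ae_restrict_iff' hB.compl).2 ?_)
          filter_upwards [hx'] with y hy hyB
          rw [hy hx'B.1 hyB, zero_sub, enorm_neg]
      _ ≤ _ := lintegral_mono_set inter_subset_right
  rw [ENNReal.le_div_iff_mul_le (Or.inl hc0) (Or.inl hctop), mul_comm, ← mul_div_assoc]
  exact ENNReal.div_le_div_right hle _

/-- A path from a point at which `B` does not have density zero stays within such points, so strong
connectivity excludes isolated sets. -/
lemma isIrreducible_of_isConnectedByPaths {σ : Lp ℝ ∞ (Ω.measure.prod Ω.measure)}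
    {k : EuclideanSpace ℝ (Fin d) → EuclideanSpace ℝ (Fin d) → ℝ} {C : ℝ}
    (hk : IsBoundedKernel k C)
    (hσ : ∀ᵐ x ∂Ω.measure, ∀ᵐ y ∂Ω.measure, σ (x, y) = k x y)
    (hG : IsConnectedByPaths (kernelGraph σ)) : IsIrreducible Ω.measure k := by
  intro B hB hkB
  by_contra! hpos
  have hσB : ∀ᵐ x ∂Ω.measure, ∀ᵐ y ∂Ω.measure, x ∈ B → y ∉ B → σ (x, y) = 0 := by
    filter_upwards [hσ, hkB] with x h1 h2
    filter_upwards [h1, h2] with y h3 h4 hx hy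
    rw [h3, h4 hx hy]
  have hΩ : ∀ᵐ x ∂Ω.measure, x ∈ Ω.carrier := ae_restrict_mem Ω.isOpen.measurableSet
  have hgood : ∀ᵐ x ∂Ω.measure, IsLebesguePoint σ x ∧ (HasDensityZero Ω B x ↔ x ∉ B) := by
    filter_upwards [hΩ, ae_isSectionAt hk hσ, ae_hasDensityZero_iff hB] with x h1 h2 h3
    exact ⟨⟨h1, h2⟩, h3⟩
  obtain ⟨a, haB, ha, ha'⟩ :=
    ((frequently_ae_mem_iff.2 hpos.1).and_eventually hgood).exists
  obtain ⟨b, hbB, hb, hb'⟩ :=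
    ((frequently_ae_mem_iff.2 hpos.2).and_eventually hgood).exists
  have hab : (⟨a, ha⟩ : {x // IsLebesguePoint σ x}) ≠ ⟨b, hb⟩ := fun h =>
    hbB (Subtype.mk.inj h ▸ haB)
  obtain ⟨r, -, p, -, hp0, hpr, hadj⟩ := hG _ _ hab
  have hall : ∀ i, ¬ HasDensityZero Ω B (p i).1 := by
    intro i
    induction i using Fin.induction with
    | zero => rw [hp0, ha', not_not]; exact haB
    | succ i ih =>
      obtain ⟨-, g, hg, -, hsupp⟩ := hadj i
      refine fun hz => hsupp ?_
      refine tendsto_of_tendsto_of_tendsto_of_le_of_le tendsto_const_nhds hz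
        (fun _ => zero_le) fun s => ENNReal.div_le_div_right (measure_mono_ae ?_) _
      filter_upwards [hg.ae_eq_zero hB hσB ih] with y hy hyg
      exact ⟨not_not.1 fun hyB => hyg.1 (hy hyB), hyg.2⟩
  refine hall (Fin.last r) ?_
  rw [hpr]
  exact hb'.2 hbB

/-! ### The kernel of the adjoint -/

section Kernel

variable {α : Type*} [MeasurableSpace α] {μ : Measure α}
  {σ : Lp ℝ ∞ (μ.prod μ)} {k : α → α → ℝ} {C : ℝ}

lemma totalInfluence_ae_eq (hσ : ∀ᵐ x ∂μ, ∀ᵐ y ∂μ, σ (x, y) = k x y) :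
    totalInfluence σ =ᵐ[μ] fun x => ∫ y, k x y ∂μ := by
  filter_upwards [hσ] with x hx
  exact integral_congr_ae hx

/-- A positive value of `essInf` is genuine: the supremum defining it, if it is positive, is taken
over a set containing a positive number. -/
lemma exists_pos_le_totalInfluence (h : 0 < essInf (totalInfluence σ) μ) :
    ∃ δ > 0, ∀ᵐ x ∂μ, δ ≤ totalInfluence σ x := by
  by_contra! hcon
  refine h.not_ge (Real.sSup_nonpos fun δ hδ => ?_)
  by_contra hpos
  exact (hcon δ (not_le.1 hpos)) (Eventually.mono (show ∀ᵐ x ∂μ, δ ≤ totalInfluence σ x from hδ)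
      fun x hx => not_lt.2 hx)

variable [IsFiniteMeasure μ]

lemma inner_onesFun (v : Lp ℝ 2 μ) : inner ℝ v (onesFun μ) = ∫ x, v x ∂μ := by
  rw [L2.inner_def]
  refine integral_congr_ae ?_
  filter_upwards [Lp.coeFn_const (p := 2) (μ := μ) (c := (1 : ℝ))] with x hx
  unfold onesFun
  rw [hx]
  simp

lemma consensusOp_ae_eq (hk : IsBoundedKernel k C)
    (hσ : ∀ᵐ x ∂μ, ∀ᵐ y ∂μ, σ (x, y) = k x y) (z : Lp ℝ 2 μ) :
    consensusOp σ z =ᵐ[μ] fun x => ∫ y, k x y * z y ∂μ - (∫ y, k x y ∂μ) * z x := by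
  filter_upwards [consensusOp_coe σ z, hσ] with x h1 h2
  rw [h1, ← integral_mul_const, ← integral_sub (hk.integrable_left_mul x (integrable_coe z))
    ((hk.integrable_left x).mul_const _)]
  refine integral_congr_ae ?_
  filter_upwards [h2] with y hy
  rw [hy]
  ring

lemma adjoint_consensusOp_eq_zero_iff (hk : IsBoundedKernel k C)
    (hσ : ∀ᵐ x ∂μ, ∀ᵐ y ∂μ, σ (x, y) = k x y) (v : Lp ℝ 2 μ) :
    ContinuousLinearMap.adjoint (consensusOp σ) v = 0 ↔ IsStationary μ k v := by
  have hmem := hk.memLp_inflow_sub_outflow (Lp.memLp v)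
  have hadj : ContinuousLinearMap.adjoint (consensusOp σ) v = hmem.toLp := by
    refine ext_inner_right ℝ fun z => ?_
    rw [ContinuousLinearMap.adjoint_inner_left, L2.inner_def, L2.inner_def]
    calc _ = ∫ x, v x * (∫ y, k x y * z y ∂μ - (∫ y, k x y ∂μ) * z x) ∂μ := by
          refine integral_congr_ae ?_
          filter_upwards [consensusOp_ae_eq hk hσ z] with x hx
          rw [hx, real_inner_comm, RCLike.inner_apply, conj_trivial]
      _ = _ := hk.integral_mul_consensus (Lp.memLp v) (Lp.memLp z)
      _ = _ := by
          refine integral_congr_ae ?_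
          filter_upwards [hmem.coeFn_toLp] with x hx
          rw [hx, real_inner_comm, RCLike.inner_apply, conj_trivial]
  rw [hadj, Lp.eq_zero_iff_ae_eq_zero]
  refine (eventually_congr ?_ : _ ↔ IsStationary μ k v)
  filter_upwards [hmem.coeFn_toLp] with y hy
  rw [hy]
  exact sub_eq_zero

/-- The range of `A` is not dense: the total influence `S` is not a limit of functions `A z`, by the
maximum principle. Hence its orthogonal complement, the kernel of `A*`, is nontrivial. -/
lemma exists_adjoint_eq_zero [NeZero μ] (hk : IsBoundedKernel k C)
    (hσ : ∀ᵐ x ∂μ, ∀ᵐ y ∂μ, σ (x, y) = k x y) {δ : ℝ} (hδ : 0 < δ)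
    (hS : ∀ᵐ x ∂μ, δ ≤ ∫ y, k x y ∂μ) :
    ∃ v : Lp ℝ 2 μ, v ≠ 0 ∧ ContinuousLinearMap.adjoint (consensusOp σ) v = 0 := by
  by_contra! hcon
  have hC : 0 ≤ C := by
    obtain ⟨x, -⟩ := hS.exists
    exact (hk.nonneg x x).trans (hk.le x x)
  have hdense : (consensusOp σ).range.topologicalClosure = ⊤ := by
    rw [Submodule.topologicalClosure_eq_top_iff, ContinuousLinearMap.orthogonal_range,
      Submodule.eq_bot_iff]
    exact fun v hv => not_not.1 fun hne => hcon v hne hv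
  have hSmem : MemLp (fun x => ∫ y, k x y ∂μ) 2 μ :=
    MemLp.of_bound hk.stronglyMeasurable_outflow.aestronglyMeasurable _
      (ae_of_all _ hk.outflow_norm_le)
  have hcl : hSmem.toLp ∈ closure ((consensusOp σ).range : Set (Lp ℝ 2 μ)) := by
    rw [← Submodule.topologicalClosure_coe, hdense]
    trivial
  set K : ℝ := C * ‖onesFun μ‖ + 1
  have hK : 0 < K := by positivity
  obtain ⟨_, ⟨z, rfl⟩, hz⟩ := Metric.mem_closure_iff.1 hcl (δ ^ 2 / 2 / K) (by positivity)
  set r : Lp ℝ 2 μ := consensusOp σ z - hSmem.toLp with hr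
  have hrn : ‖r‖ ≤ δ ^ 2 / 2 / K := by
    rw [hr, ← dist_eq_norm, dist_comm]
    exact hz.le
  have hr1 : ∫ x, |r x| ∂μ ≤ ‖onesFun μ‖ * ‖r‖ := by
    have : ∫ x, |r x| ∂μ = inner ℝ |r| (onesFun μ) := by
      rw [inner_onesFun]
      exact integral_congr_ae ((Lp.coeFn_abs r).mono fun x hx => hx.symm)
    rw [this, mul_comm, ← norm_abs_eq_norm r]
    exact real_inner_le_norm _ _
  refine hk.not_consensus_eq_outflow_add hδ hS (integrable_coe z) (integrable_coe r) ?_ ?_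
  · calc C * ∫ x, |r x| ∂μ ≤ C * (‖onesFun μ‖ * ‖r‖) := by gcongr
      _ = (C * ‖onesFun μ‖) * ‖r‖ := by ring
      _ ≤ K * (δ ^ 2 / 2 / K) := by
        gcongr
        exact (lt_add_one _).le
      _ = δ ^ 2 / 2 := by field_simp
  · filter_upwards [consensusOp_ae_eq hk hσ z, Lp.coeFn_sub (consensusOp σ z) hSmem.toLp,
      hSmem.coeFn_toLp] with x h1 h2 h3
    rw [hr, h2, Pi.sub_apply, h1, h3]
    ring

end Kernel

end Consensus

open Consensus in
theorem theorem1 :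
    -- finite dimension
    (∀ (N : ℕ) (_ : 1 ≤ N) (σ : Matrix (Fin N) (Fin N) ℝ)
      (_ : ∀ i j, i ≠ j → 0 ≤ σ i j) (_ : IsConnectedByPaths (matrixGraph σ)),
      ∃ v : EuclideanSpace ℝ (Fin N),
        (ContinuousLinearMap.adjoint (consensusMatrixOp σ) v = 0 ∧
          (∀ i, 0 < v i) ∧ inner ℝ v (onesVec N) = 1) ∧
        (∀ w : EuclideanSpace ℝ (Fin N),
          ContinuousLinearMap.adjoint (consensusMatrixOp σ) w = 0 →
          (∀ i, 0 < w i) → inner ℝ w (onesVec N) = 1 → w = v) ∧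
        (∀ y : ℝ → EuclideanSpace ℝ (Fin N), IsSolution (consensusMatrixOp σ) y →
          ∀ s t : ℝ, 0 ≤ s → 0 ≤ t →
            weightedMean (onesVec N) v (y s) = weightedMean (onesVec N) v (y t))) ∧
    -- infinite dimension
    (∀ (d : ℕ) (_ : 1 ≤ d) (Ω : BoundedOpen d) (σ : Lp ℝ ∞ (Ω.measure.prod Ω.measure))
      (_ : ∀ᵐ p ∂(Ω.measure.prod Ω.measure), 0 ≤ σ p) (_ : IsStronglyConnectedKernel σ),
      ∃ v : Lp ℝ 2 Ω.measure,
        (ContinuousLinearMap.adjoint (consensusOp σ) v = 0 ∧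
          (∀ᵐ x ∂Ω.measure, 0 < v x) ∧ inner ℝ v (onesFun Ω.measure) = 1) ∧
        (∀ w : Lp ℝ 2 Ω.measure,
          ContinuousLinearMap.adjoint (consensusOp σ) w = 0 →
          (∀ᵐ x ∂Ω.measure, 0 < w x) → inner ℝ w (onesFun Ω.measure) = 1 → w = v) ∧
        (∀ y : ℝ → Lp ℝ 2 Ω.measure, IsSolution (consensusOp σ) y →
          ∀ s t : ℝ, 0 ≤ s → 0 ≤ t →
            weightedMean (onesFun Ω.measure) v (y s) =
              weightedMean (onesFun Ω.measure) v (y t))) := by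
  refine ⟨fun N hN σ hσ hG => ?_, fun d _ Ω σ hσ hG => ?_⟩
  -- In both cases `v` is the absolute value of a nonzero element of `ker A*`, normalized.
  · obtain ⟨u, hu0, hu⟩ := exists_stationary hN σ
    have habs := stationary_abs hσ hu
    have hpos : ∀ i, 0 < |u i| := stationary_pos hσ hG (v := fun i => |u i|) habs
      (fun i => abs_nonneg _) fun h => hu0 (funext fun i => abs_eq_zero.1 (congrFun h i))
    have hm : 0 < ∑ i, |u i| := Finset.sum_pos (fun i _ => hpos i) ⟨⟨0, hN⟩, Finset.mem_univ _⟩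
    set v : EuclideanSpace ℝ (Fin N) := WithLp.toLp 2 fun i => (∑ i, |u i|)⁻¹ * |u i| with hv
    have hvker : ContinuousLinearMap.adjoint (consensusMatrixOp σ) v = 0 := by
      rw [adjoint_consensusMatrixOp_eq_zero_iff]
      intro j
      simp only [hv, mul_left_comm _ (∑ i, |u i|)⁻¹]
      rw [← Finset.mul_sum, habs]
    have hv1 : inner ℝ v (onesVec N) = 1 := by
      rw [inner_onesVec, hv, ← Finset.mul_sum]
      exact inv_mul_cancel₀ hm.ne'
    refine ⟨v, ⟨hvker, fun i => mul_pos (inv_pos.2 hm) (hpos i), hv1⟩, fun w hw _ hw1 => ?_,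
      fun y hy s t hs ht => hy.weightedMean_eq hvker _ hs ht⟩
    rw [← sub_eq_zero, ← WithLp.ofLp_eq_zero 2]
    refine stationary_eq_zero hσ hG ((adjoint_consensusMatrixOp_eq_zero_iff (w - v)).1 ?_) ?_
    · rw [map_sub, hw, hvker, sub_zero]
    · rw [← inner_onesVec, inner_sub_left, hw1, hv1, sub_self]
  · obtain ⟨k, C, hk, hσk⟩ := exists_isBoundedKernel σ hσ
    have hirr := isIrreducible_of_isConnectedByPaths hk hσk hG.1
    obtain ⟨δ, hδ, hS⟩ := exists_pos_le_totalInfluence hG.2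
    replace hS : ∀ᵐ x ∂Ω.measure, δ ≤ ∫ y, k x y ∂Ω.measure := by
      filter_upwards [hS, totalInfluence_ae_eq hσk] with x h1 h2
      rwa [← h2]
    have : NeZero Ω.measure := ⟨fun h => (Ω.isOpen.measure_pos volume Ω.nonempty).ne'
      (Measure.restrict_eq_zero.1 h)⟩
    obtain ⟨u, hu0, hu⟩ := exists_adjoint_eq_zero hk hσk hδ hS
    have habs : IsStationary Ω.measure k fun x => |u x| :=
      hk.isStationary_abs (integrable_coe u) ((adjoint_consensusOp_eq_zero_iff hk hσk u).1 hu)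
    have hui := (integrable_coe u).abs
    have hpos : ∀ᵐ x ∂Ω.measure, 0 < |u x| :=
      hk.pos_of_isStationary hirr hui (Lp.stronglyMeasurable u).measurable.abs habs
        (ae_of_all _ fun x => abs_nonneg _) fun h => hu0 <| (Lp.eq_zero_iff_ae_eq_zero).2 <|
          h.mono fun x hx => abs_eq_zero.1 hx
    have hm : 0 < ∫ x, |u x| ∂Ω.measure := by
      refine (integral_nonneg fun x => abs_nonneg _).lt_of_ne' fun h => ?_
      have h0 := (integral_eq_zero_iff_of_nonneg (fun x => abs_nonneg _) hui).1 h
      obtain ⟨x, hx1, hx2⟩ := (hpos.and h0).exists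
      exact hx1.ne' hx2
    set v : Lp ℝ 2 Ω.measure := (∫ x, |u x| ∂Ω.measure)⁻¹ • |u| with hv
    have hvcoe : ∀ᵐ x ∂Ω.measure, v x = (∫ x, |u x| ∂Ω.measure)⁻¹ * |u x| := by
      filter_upwards [Lp.coeFn_smul (∫ x, |u x| ∂Ω.measure)⁻¹ |u|, Lp.coeFn_abs u] with x h1 h2
      rw [hv, h1, Pi.smul_apply, h2, smul_eq_mul]
    have hvker : ContinuousLinearMap.adjoint (consensusOp σ) v = 0 := by
      rw [hv, map_smul, (adjoint_consensusOp_eq_zero_iff hk hσk |u|).2, smul_zero]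
      filter_upwards [habs, Lp.coeFn_abs u] with y h1 h2
      rw [h2, ← h1]
      refine integral_congr_ae ?_
      filter_upwards [Lp.coeFn_abs u] with x hx
      rw [hx]
    have hv1 : inner ℝ v (onesFun Ω.measure) = 1 := by
      rw [inner_onesFun, integral_congr_ae hvcoe, integral_const_mul]
      exact inv_mul_cancel₀ hm.ne'
    refine ⟨v, ⟨hvker, ?_, hv1⟩, fun w hw _ hw1 => ?_,
      fun y hy s t hs ht => hy.weightedMean_eq hvker _ hs ht⟩
    · filter_upwards [hvcoe, hpos] with x h1 h2
      rw [h1]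
      exact mul_pos (inv_pos.2 hm) h2
    · rw [← sub_eq_zero, Lp.eq_zero_iff_ae_eq_zero]
      refine hk.stationary_ae_eq_zero hirr (integrable_coe _)
        (Lp.stronglyMeasurable _).measurable
        ((adjoint_consensusOp_eq_zero_iff hk hσk (w - v)).1 ?_) ?_
      · rw [map_sub, hw, hvker, sub_zero]
      · rw [← inner_onesFun, inner_sub_left, hw1, hv1, sub_self]
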